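/- Let $\mathcal M$ be a commutative $W^*$-algebra with unit $\mathbf 1$, let $\mathcal N=\mathcal M\otimes M_2$ be the $W^*$-algebra of $2\times 2$ matrices over $\mathcal M$, and let $a\varepsilon_{ij}\in\mathcal N$ denote the matrix with entry $a\in\mathcal M$ at position $(i,j)$ and zeros elsewhere. Let $H$ be a complex Hilbert space with scalar product $\langle\cdot,\cdot\rangle$, linear in the first variable. For a $W^*$-algebra $\mathcal A$, an orthogonal vector field (OVF) is a bounded linear map $F:\mathcal A\to H$ such that $\langle F(p),F(q)\rangle=0$ for all projections $p,q\in\mathcal A$ with $pq=0$; a $w^*$-continuous OVF is a linear map $F:\mathcal A\to H$ with this orthogonality property that is continuous from the $w^*$-topology of $\mathcal A$ to the weak topology of $H$. Let $F_{ij}:\mathcal M\to H$ $(i,j=1,2)$ be linear maps such that (i) $\langle F_{11}(a),F_{22}(b)\rangle=\langle F_{12}(a),F_{21}(b)\rangle=0$ for all $a,b\in\mathcal M$; (ii) $\|F_{12}(a)\|^2+\|F_{21}(a)\|^2=\|F_{11}(a)\|^2+\|F_{22}(a)\|^2$ for all $a\in\mathcal M$; (iii) $\langle F_{ij}(a),F_{kl}(b)\rangle=\langle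 F_{ij}(b^*a),F_{kl}(\mathbf 1)\rangle$ for all $a,b\in\mathcal M$ and $i,j,k,l\in\{1,2\}$; (iv) $\langle F_{12}(\pi),F_{11}(\mathbf 1)\rangle=\langle F_{22}(\mathbf 1),F_{21}(\pi)\rangle$ and $\langle F_{21}(\pi),F_{11}(\mathbf 1)\rangle=\langle F_{22}(\mathbf 1),F_{12}(\pi)\rangle$ for all projections $\pi\in\mathcal M$. Then there is exactly one linear map $F:\mathcal N\to H$ with $F(a\varepsilon_{ij})=F_{ij}(a)$ for all $a\in\mathcal M$ and $i,j=1,2$. If all $F_{ij}$ are OVFs, then $F$ is an OVF; if all $F_{ij}$ are $w^*$-continuous OVFs, then $F$ is a $w^*$-continuous OVF. -/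

import Mathlib

universe u v

section OrthogonalVectorFields

variable {A : Type u} [CStarAlgebra A]
variable {H : Type v} [NormedAddCommGroup H] [InnerProductSpace ℂ H]

/-- The `w*`-topology of a `W*`-algebra `A`: the topology `σ(A, X)`, where `X` is a Banach space
whose dual is isometrically (conjugate-linearly) identified with `A`, as in `WStarAlgebra`.
The predual of a `W*`-algebra is unique, so the topologies `σ(A, X)` are all the same;
the infimum over all presentations `(X, e)` of `A` as a dual space avoids choosing one of them. -/
@[reducible] noncomputable def wstarTopology (A : Type u) [CStarAlgebra A] : TopologicalSpace A :=
  ⨅ (X : Type u) (_ : NormedAddCommGroup X) (_ : NormedSpace ℂ X) (_ : CompleteSpace X)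
    (e : StrongDual ℂ X ≃ₗᵢ⋆[ℂ] A),
    TopologicalSpace.induced
      (fun a : A => (StrongDual.toWeakDual (e.symm a) : WeakDual ℂ X)) inferInstance

/-- Continuity from the `w*`-topology of `A` to the weak topology of `H`. -/
def IsWStarContinuous (F : A →ₗ[ℂ] H) : Prop :=
  @Continuous A (WeakSpace ℂ H) (wstarTopology A) inferInstance
    (fun a => toWeakSpace ℂ H (F a))

/-- The orthogonality property: orthogonal projections are mapped to orthogonal vectors. -/
def PreservesOrthogonality (F : A →ₗ[ℂ] H) : Prop :=
  ∀ p q : A, IsStarProjection p → IsStarProjection q → p * q = 0 → inner ℂ (F p) (F q) = 0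

/-- An orthogonal vector field (OVF): a bounded linear map with the orthogonality property. -/
structure IsOVF (F : A →ₗ[ℂ] H) : Prop where
  bounded : ∃ C : ℝ, ∀ a : A, ‖F a‖ ≤ C * ‖a‖
  orthogonality : PreservesOrthogonality F

/-- A `w*`-continuous OVF: a linear map with the orthogonality property that is continuous
from the `w*`-topology to the weak topology. -/
structure IsWStarContinuousOVF (F : A →ₗ[ℂ] H) : Prop where
  continuity : IsWStarContinuous F
  orthogonality : PreservesOrthogonality F

end OrthogonalVectorFields

section Reductions

variable {M : Type u} [CommCStarAlgebra M]
variable {H : Type v} [NormedAddCommGroup H] [InnerProductSpace ℂ H]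

/-- Conditions (i)-(iv) on a family `G i j : M → H`; the indices `1, 2` are written `0, 1`.
The scalar product `⟨x, y⟩`, linear in `x`, is `inner ℂ y x` in Mathlib's convention. -/
structure ReductionConditions (G : Fin 2 → Fin 2 → M →ₗ[ℂ] H) : Prop where
  /-- (i), first part: `⟨G₁₁ a, G₂₂ b⟩ = 0`. -/
  diag_orthogonal : ∀ a b : M, inner ℂ (G 1 1 b) (G 0 0 a) = 0
  /-- (i), second part: `⟨G₁₂ a, G₂₁ b⟩ = 0`. -/
  offDiag_orthogonal : ∀ a b : M, inner ℂ (G 1 0 b) (G 0 1 a) = 0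
  /-- (ii): `‖G₁₂ a‖² + ‖G₂₁ a‖² = ‖G₁₁ a‖² + ‖G₂₂ a‖²`. -/
  norm_sq : ∀ a : M, ‖G 0 1 a‖ ^ 2 + ‖G 1 0 a‖ ^ 2 = ‖G 0 0 a‖ ^ 2 + ‖G 1 1 a‖ ^ 2
  /-- (iii): `⟨Gᵢⱼ a, Gₖₗ b⟩ = ⟨Gᵢⱼ (b* a), Gₖₗ 1⟩`. -/
  module_property : ∀ (a b : M) (i j k l : Fin 2),
    inner ℂ (G k l b) (G i j a) = inner ℂ (G k l 1) (G i j (star b * a))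
  /-- (iv), first part: `⟨G₁₂ π, G₁₁ 1⟩ = ⟨G₂₂ 1, G₂₁ π⟩` for projections `π`. -/
  symmetry_one : ∀ π : M, IsStarProjection π →
    inner ℂ (G 0 0 1) (G 0 1 π) = inner ℂ (G 1 0 π) (G 1 1 1)
  /-- (iv), second part: `⟨G₂₁ π, G₁₁ 1⟩ = ⟨G₂₂ 1, G₁₂ π⟩` for projections `π`. -/
  symmetry_two : ∀ π : M, IsStarProjection π →
    inner ℂ (G 0 0 1) (G 1 0 π) = inner ℂ (G 0 1 π) (G 1 1 1)

/-- `F (a εᵢⱼ) = G i j a`, where `a εᵢⱼ` is the matrix with entry `a` at `(i, j)` and `0`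
elsewhere. -/
def HasReductions (F : CStarMatrix (Fin 2) (Fin 2) M →ₗ[ℂ] H)
    (G : Fin 2 → Fin 2 → M →ₗ[ℂ] H) : Prop :=
  ∀ (i j : Fin 2) (a : M), F (CStarMatrix.ofMatrix (Matrix.single i j a)) = G i j a

end Reductions

/-!
The map `F` is forced: `F a = ∑ i j, G i j (a i j)` (`ofReductions`). What has to be shown is that
it is bounded, respectively `w*`-continuous, and that it preserves orthogonality.

**Orthogonality.** By (iii) every scalar product `⟨G i j a, G k l b⟩` is the value at `b* a` of the
linear functional `c ↦ ⟨G i j c, G k l 1⟩` (`innerOne`). Condition (iv) says that certain pairs of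
these functionals agree on projections. The functionals are norm continuous, and the span of the
projections of a commutative `W*`-algebra is norm dense, so they agree everywhere
(`innerOne_symmetry`). For projections `p`, `q` with `p q = 0`, also `q p = 0`, and the entries of
these two matrix identities make the sixteen terms of `⟨F p, F q⟩` cancel: four vanish by (i), eight
cancel in pairs by (iv), and the remaining four are, up to sign, the functionals of (ii) at the one
self-adjoint element `q₁₁ p₁₁` (`preservesOrthogonality`).

**Density of projections.** By Banach-Alaoglu, for a bounded sequence in a dual Banach space there
is a point lying in every closed ball that eventually contains the sequence. In `C(K, ℂ)`, the
functions with values in a real interval form an intersection of closed balls, so such a point for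
the sequence `min 1 (n (f - 1/2)⁺)` is its least upper bound. It is a projection, since its square
is an upper bound too. Hence projections separate the points of the character space, and
Stone-Weierstrass applies.

**`w*`-continuity.** It suffices that taking an entry is `w*`-continuous from `M₂(M)` to `M`. Given
a predual `X` of `M`, the functionals `a ↦ ∑ i j, ⟨a i j, x i j⟩` with `x i j ∈ X` form a predual of
the algebra of matrices over `M`, isometrically (`dualMatrixPredual`). The isometry rests on the
fact that, `M` being commutative, the norm of a matrix `a` is the supremum of `‖∑ ξᵢ ηⱼ aᵢⱼ‖` over
unit vectors `ξ`, `η` with complex coordinates (`norm_bilin_le`, `norm_le_of_forall_bilin`): on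
characters this is the formula for the operator norm of a complex matrix.
-/

open Filter Topology

/-! ### Density of the span of the projections -/

/-- A bounded sequence in a `W*`-algebra has a `w*`-cluster point, and closed balls are
`w*`-closed. This is the only use made of the predual in the density of projections. -/
theorem exists_mem_closedBall_of_eventually {A : Type u} [CStarAlgebra A] [WStarAlgebra A]
    (g : ℕ → A) {R : ℝ} (hg : ∀ n, ‖g n‖ ≤ R) :
    ∃ x : A, ∀ (c : A) (r : ℝ), (∀ᶠ n in atTop, ‖g n - c‖ ≤ r) → ‖x - c‖ ≤ r := by
  obtain ⟨X, _, _, _, ⟨e⟩⟩ := WStarAlgebra.exists_predual (M := A)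
  let φ : ℕ → WeakDual ℂ X := fun n => StrongDual.toWeakDual (e.symm (g n))
  have key : ∀ (y : WeakDual ℂ X) (c : A) (r : ℝ),
      y ∈ WeakDual.toStrongDual ⁻¹' Metric.closedBall (e.symm c) r ↔
        ‖e (WeakDual.toStrongDual y) - c‖ ≤ r := by
    intro y c r
    rw [Set.mem_preimage, mem_closedBall_iff_norm, ← e.norm_map, map_sub, e.apply_symm_apply]
  have hφ : ∀ n (c : A) (r : ℝ), ‖g n - c‖ ≤ r →
      φ n ∈ WeakDual.toStrongDual ⁻¹' Metric.closedBall (e.symm c) r := by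
    intro n c r h
    rw [key]
    simpa [φ] using h
  obtain ⟨y, -, hy⟩ := (WeakDual.isCompact_closedBall (e.symm 0) R).ultrafilter_le_nhds
    ((hyperfilter ℕ).map φ)
    (le_principal_iff.2 (Ultrafilter.mem_map.2 (univ_mem' fun n => hφ n 0 R (by simpa using hg n))))
  refine ⟨e (WeakDual.toStrongDual y), fun c r h => (key y c r).1 ?_⟩
  refine (WeakDual.isClosed_closedBall (e.symm c) r).mem_of_tendsto
    (f := φ) (b := (hyperfilter ℕ : Filter ℕ)) hy ?_
  have h' : ∀ᶠ n in (hyperfilter ℕ : Filter ℕ), ‖g n - c‖ ≤ r := Nat.hyperfilter_le_atTop h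
  exact h'.mono fun n hn => hφ n c r hn

/-- The discs with centre `t * I` through `R` and `-R` intersect in the segment `[-R, R]`. -/
theorem Complex.im_eq_zero_and_abs_re_le {z : ℂ} {R : ℝ} (hR : 0 ≤ R)
    (h : ∀ t : ℝ, ‖z - t * Complex.I‖ ≤ √(R ^ 2 + t ^ 2)) : z.im = 0 ∧ |z.re| ≤ R := by
  have h2 : ∀ t : ℝ, z.re ^ 2 + (z.im - t) ^ 2 ≤ R ^ 2 + t ^ 2 := by
    intro t
    have := (Real.le_sqrt (norm_nonneg _) (by positivity)).1 (h t)
    rw [← Complex.normSq_eq_norm_sq, Complex.normSq_apply] at this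
    simp at this
    linarith
  have him : z.im = 0 := by
    by_contra hne
    -- For this `t`, `(z.im - t) ^ 2 - t ^ 2 = z.im ^ 2 + R ^ 2 + 1`.
    have := h2 (-(R ^ 2 + 1) / (2 * z.im))
    have e1 : (z.im - -(R ^ 2 + 1) / (2 * z.im)) ^ 2 =
      z.im ^ 2 + (R ^ 2 + 1) + (-(R ^ 2 + 1) / (2 * z.im)) ^ 2 := by
      field_simp
      ring
    rw [e1] at this
    nlinarith [sq_nonneg z.re, sq_nonneg z.im]
  refine ⟨him, abs_le_of_sq_le_sq ?_ hR⟩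
  have := h2 0
  simp [him] at this
  simpa using this

section
variable {K : Type*} [TopologicalSpace K] [CompactSpace K]

/-- A real continuous function, regarded as a complex one. -/
def complexify (f : C(K, ℝ)) : C(K, ℂ) := ⟨fun k => (f k : ℂ), by fun_prop⟩

/-- Order intervals of real functions are intersections of closed balls of `C(K, ℂ)`: if `g n`
eventually lies between `h` and `h + 2 * R`, then so does `x`, and `x` is real. -/
theorem eq_ofReal_and_mem_Icc_of_eventually {g : ℕ → C(K, ℝ)} {x : C(K, ℂ)}
    (hx : ∀ (c : C(K, ℂ)) (r : ℝ), (∀ᶠ n in atTop, ‖complexify (g n) - c‖ ≤ r) → ‖x - c‖ ≤ r)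
    (h : C(K, ℝ)) {R : ℝ} (hR : 0 ≤ R)
    (hg : ∀ᶠ n in atTop, ∀ k, h k ≤ g n k ∧ g n k ≤ h k + 2 * R) (k : K) :
    (x k).im = 0 ∧ h k ≤ (x k).re ∧ (x k).re ≤ h k + 2 * R := by
  have hball : ∀ t : ℝ, ‖(x k - (h k + R : ℝ)) - t * Complex.I‖ ≤ √(R ^ 2 + t ^ 2) := by
    intro t
    let c : C(K, ℂ) := ⟨fun k => (h k + R : ℝ) + t * Complex.I, by fun_prop⟩
    have := (ContinuousMap.norm_coe_le_norm (x - c) k).trans (hx c (√(R ^ 2 + t ^ 2)) ?_)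
    · simpa [c, sub_sub] using this
    filter_upwards [hg] with n hn
    refine (ContinuousMap.norm_le _ (Real.sqrt_nonneg _)).2 fun l => Real.le_sqrt_of_sq_le ?_
    rw [← Complex.normSq_eq_norm_sq, Complex.normSq_apply]
    simp [c, complexify]
    nlinarith [hn l]
  obtain ⟨h1, h2⟩ := Complex.im_eq_zero_and_abs_re_le hR hball
  simp at h1 h2
  rw [abs_le] at h2
  exact ⟨h1, by linarith, by linarith⟩

/-- If bounded sequences in `C(K, ℂ)` have points lying in every closed ball that eventually contains
the sequence, then projections separate the points of `K`. -/
theorem exists_isStarProjection_separating [T2Space K]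
    (hK : ∀ (g : ℕ → C(K, ℂ)) (R : ℝ), (∀ n, ‖g n‖ ≤ R) → ∃ x : C(K, ℂ), ∀ (c : C(K, ℂ)) (r : ℝ),
      (∀ᶠ n in atTop, ‖g n - c‖ ≤ r) → ‖x - c‖ ≤ r)
    {k l : K} (hkl : k ≠ l) : ∃ p : C(K, ℂ), IsStarProjection p ∧ p k = 0 ∧ p l = 1 := by
  obtain ⟨f, hf0, hf1, hf⟩ := exists_continuous_zero_one_of_isClosed (isClosed_singleton (x := k))
    (isClosed_singleton (x := l)) (by simpa using hkl)
  have hfk : f k = 0 := hf0 rfl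
  have hfl : f l = 1 := hf1 rfl
  let g : ℕ → C(K, ℝ) := fun n => ⟨fun a => min 1 (n * max (f a - 1 / 2) 0), by fun_prop⟩
  have hg : ∀ n a, g n a = min 1 (n * max (f a - 1 / 2) 0) := fun n a => rfl
  have hg0 : ∀ n a, 0 ≤ g n a := fun n a => le_min zero_le_one (by positivity)
  have hg1 : ∀ n a, g n a ≤ 1 := fun n a => min_le_left _ _
  have hmono : ∀ m n a, m ≤ n → g m a ≤ g n a := by
    intro m n a hmn
    rw [hg, hg]
    gcongr
  -- `x` turns out to be the least upper bound of the increasing sequence `g`.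
  obtain ⟨x, hx⟩ := hK (fun n => complexify (g n)) 1 fun n =>
    (ContinuousMap.norm_le _ zero_le_one).2 fun a => by
      simpa [complexify, abs_of_nonneg (hg0 n a)] using hg1 n a
  have lower : ∀ m a, (x a).im = 0 ∧ g m a ≤ (x a).re := by
    intro m a
    have := eq_ofReal_and_mem_Icc_of_eventually hx (g m) zero_le_one
      (eventually_atTop.2 ⟨m, fun n hn b => ⟨hmono m n b hn, by linarith [hg0 m b, hg1 n b]⟩⟩) a
    exact ⟨this.1, this.2.1⟩
  have upper : ∀ w : C(K, ℝ), (∀ a, w a ≤ 1) → (∀ n a, g n a ≤ w a) → ∀ a, (x a).re ≤ w a := by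
    intro w hw hgw a
    have := eq_ofReal_and_mem_Icc_of_eventually hx (w - 1) (R := 1 / 2) (by norm_num)
      (Eventually.of_forall fun n b => ⟨by simp; linarith [hg0 n b, hw b], by simpa using hgw n b⟩) a
    simpa using this.2.2
  have hx0 : ∀ a, 0 ≤ (x a).re := fun a => (hg0 0 a).trans (lower 0 a).2
  have hx1 : ∀ a, (x a).re ≤ 1 := upper 1 (fun _ => le_rfl) hg1
  -- `x` is `1` wherever some `g n` is positive, so its square is again an upper bound.
  have hsq : ∀ a, (x a).re ≤ (x a).re ^ 2 := by
    refine upper ⟨fun a => (x a).re ^ 2, by fun_prop⟩ (fun a => ?_) (fun n a => ?_)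
    · exact pow_le_one₀ (hx0 a) (hx1 a)
    · show g n a ≤ (x a).re ^ 2
      by_cases ha : f a ≤ 1 / 2
      · rw [hg, max_eq_right (by linarith)]
        simp
        positivity
      · push Not at ha
        obtain ⟨m, hm⟩ := exists_nat_ge (1 / (f a - 1 / 2))
        have h1 : g m a = 1 := by
          rw [hg, max_eq_left (by linarith)]
          exact min_eq_left ((div_le_iff₀ (by linarith)).1 hm)
        have h2 := (lower m a).2
        rw [h1] at h2
        nlinarith [hg1 n a]
  have hidem : ∀ a, (x a).re ^ 2 = (x a).re := fun a =>
    le_antisymm (by nlinarith [hx0 a, hx1 a]) (hsq a)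
  refine ⟨x, ⟨?_, ?_⟩, ?_, ?_⟩
  · ext a
    apply Complex.ext
    · simpa [(lower 0 a).1, sq] using hidem a
    · simp [(lower 0 a).1]
  · ext a
    apply Complex.ext
    · simp
    · simp [(lower 0 a).1]
  -- `min 1 (2 * f)` is an upper bound that vanishes at `k`.
  · have := upper ⟨fun a => min 1 (2 * f a), by fun_prop⟩ (fun a => min_le_left _ _) (fun n a => by
      show g n a ≤ min 1 (2 * f a)
      rcases le_total (f a) (1 / 2) with ha | ha
      · rw [hg, max_eq_right (by linarith)]
        simpa using (hf a).1
      · rw [min_eq_left (by linarith)]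
        exact hg1 n a) k
    simp [hfk] at this
    exact Complex.ext (le_antisymm this (hx0 k)) (lower 0 k).1
  · have := (lower 2 l).2
    rw [hg, hfl] at this
    norm_num at this
    exact Complex.ext (le_antisymm (hx1 l) this) (lower 0 l).1

/-- The span of the projections is a star subalgebra, so that Stone-Weierstrass applies to it. -/
theorem dense_span_isStarProjection
    (hK : ∀ k l : K, k ≠ l → ∃ p : C(K, ℂ), IsStarProjection p ∧ p k = 0 ∧ p l = 1) :
    Dense (Submodule.span ℂ {p : C(K, ℂ) | IsStarProjection p} : Set C(K, ℂ)) := by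
  let S : StarSubalgebra ℂ C(K, ℂ) :=
    { Submodule.span ℂ {p : C(K, ℂ) | IsStarProjection p} with
      mul_mem' := by
        intro a b ha hb
        have := Submodule.mul_mem_mul ha hb
        rw [Submodule.span_mul_span] at this
        refine Submodule.span_mono ?_ this
        rintro _ ⟨p, hp, q, hq, rfl⟩
        exact hp.mul hq (Commute.all _ _)
      algebraMap_mem' := fun r => by
        rw [Algebra.algebraMap_eq_smul_one]
        exact Submodule.smul_mem _ _ (Submodule.subset_span (.one _))
      star_mem' := by
        intro a ha
        refine Submodule.span_induction (p := fun a _ => star a ∈ Submodule.span ℂ _)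
          (fun p hp => ?_) ?_ (fun a b _ _ ha hb => ?_) (fun c a _ ha => ?_) ha
        · rw [(show IsStarProjection p from hp).isSelfAdjoint.star_eq]
          exact Submodule.subset_span hp
        · rw [star_zero]
          exact Submodule.zero_mem _
        · rw [star_add]
          exact Submodule.add_mem _ ha hb
        · rw [star_smul]
          exact Submodule.smul_mem _ _ ha }
  have hS := ContinuousMap.starSubalgebra_topologicalClosure_eq_top_of_separatesPoints S (by
    intro k l hkl
    obtain ⟨p, hp, h0, h1⟩ := hK k l hkl
    exact ⟨p, ⟨p, Submodule.subset_span hp, rfl⟩, by simp [h0, h1]⟩)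
  rw [dense_iff_closure_eq]
  have := congrArg (fun T : StarSubalgebra ℂ C(K, ℂ) => (T : Set C(K, ℂ))) hS
  rwa [StarSubalgebra.topologicalClosure_coe, StarSubalgebra.coe_top] at this
end

theorem linearMap_eq_of_eq_on_isStarProjection {M : Type u} [CommCStarAlgebra M] [WStarAlgebra M]
    {f g : M →ₗ[ℂ] ℂ} (hf : Continuous f) (hg : Continuous g)
    (hfg : ∀ p, IsStarProjection p → f p = g p) : f = g := by
  let Γ := gelfandStarTransform M
  have hΓ : Isometry Γ := gelfandTransform_isometry M
  have hΓ' : Isometry Γ.symm := fun a b => by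
    rw [← hΓ.edist_eq, Γ.apply_symm_apply, Γ.apply_symm_apply]
  have hnorm : ∀ a, ‖Γ a‖ = ‖a‖ := (AddMonoidHomClass.isometry_iff_norm Γ).1 hΓ
  have hsep := fun k l hkl => exists_isStarProjection_separating (k := k) (l := l) (fun g R hg => by
    obtain ⟨x, hx⟩ := exists_mem_closedBall_of_eventually (fun n => Γ.symm (g n)) (R := R)
      (fun n => by rw [← hnorm, Γ.apply_symm_apply]; exact hg n)
    refine ⟨Γ x, fun c r h => ?_⟩
    have := hx (Γ.symm c) r (h.mono fun n hn => by
      rw [← hnorm, map_sub, Γ.apply_symm_apply, Γ.apply_symm_apply]; exact hn)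
    rwa [← hnorm, map_sub, Γ.apply_symm_apply] at this) hkl
  have hd := dense_span_isStarProjection hsep
  have heq : (fun a => f (Γ.symm a)) = fun a => g (Γ.symm a) := by
    refine Continuous.ext_on hd (hf.comp hΓ'.continuous) (hg.comp hΓ'.continuous) fun a ha => ?_
    refine Submodule.span_induction (p := fun a _ => f (Γ.symm a) = g (Γ.symm a))
      (fun p hp => hfg _ (IsStarProjection.map hp Γ.symm)) (by simp)
      (fun a b _ _ ha hb => by simp [ha, hb]) (fun c a _ ha => by simp [ha]) ha
  ext a
  simpa using congrFun heq (Γ a)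

/-! ### The norm of a matrix over a commutative C⋆-algebra -/

namespace CStarMatrix
variable {m n : Type*} [Fintype m] [Fintype n]

section
variable {A : Type*} [AddCommMonoid A] [Module ℂ A]

/-- The element `∑ i j, ξ i η j a i j`: the bilinear form of the matrix `a` at complex vectors. The
vectors are elements of `EuclideanSpace` for the sake of their norms. -/
noncomputable def bilin (ξ : EuclideanSpace ℂ m) (η : EuclideanSpace ℂ n)
    (a : CStarMatrix m n A) : A :=
  ∑ i, ∑ j, (ξ i * η j) • a i j
end

open WithCStarModule in
/-- The vector `ζ ⊗ 1` has norm at most `‖ζ‖`, not always `‖ζ‖`: the algebra `A` may be trivial. -/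
theorem norm_scalar_vector_le {A : Type*} [CStarAlgebra A] [PartialOrder A] [StarOrderedRing A]
    (ζ : EuclideanSpace ℂ m) : ‖(equiv A (m → A)).symm fun i => ζ i • (1 : A)‖ ≤ ‖ζ‖ := by
  have hone : ‖(1 : A)‖ ≤ 1 := by
    nontriviality A
    exact CStarRing.norm_one.le
  rw [pi_norm, EuclideanSpace.norm_eq]
  refine Real.sqrt_le_sqrt ((norm_sum_le _ _).trans (Finset.sum_le_sum fun i _ => ?_))
  rw [equiv_symm_pi_apply, inner_def, star_smul, star_one, smul_mul_smul_comm, one_mul, norm_smul]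
  simp only [norm_mul, norm_star, ← sq]
  exact mul_le_of_le_one_right (by positivity) hone

open WithCStarModule in
/-- Cauchy-Schwarz in the C⋆-module of vectors with entries in `A`. -/
theorem norm_bilin_le {A : Type*} [CStarAlgebra A] [PartialOrder A] [StarOrderedRing A]
    (ξ : EuclideanSpace ℂ m) (η : EuclideanSpace ℂ n) (a : CStarMatrix m n A) :
    ‖bilin ξ η a‖ ≤ ‖a‖ * ‖ξ‖ * ‖η‖ := by
  let v : C⋆ᵐᵒᵈ(A, m → A) := (equiv A (m → A)).symm fun i => ξ i • (1 : A)
  let w : C⋆ᵐᵒᵈ(A, n → A) := (equiv A (n → A)).symm fun j =>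
    (WithLp.toLp 2 fun j => star (η j) : EuclideanSpace ℂ n) j • (1 : A)
  have hw : ‖w‖ ≤ ‖η‖ := (norm_scalar_vector_le _).trans (by simp [EuclideanSpace.norm_eq])
  have heq : bilin ξ η a = inner A w (toCLM a v) := by
    rw [pi_inner, bilin, Finset.sum_comm]
    refine Finset.sum_congr rfl fun j _ => ?_
    simp [v, w, toCLM_apply_eq_sum, inner_def, Finset.smul_sum, smul_smul, mul_comm]
  rw [heq]
  calc ‖inner A w (toCLM a v)‖ ≤ ‖w‖ * ‖toCLM a v‖ := CStarModule.norm_inner_le _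
    _ ≤ ‖η‖ * (‖toCLM a‖ * ‖ξ‖) := by
        gcongr
        exact ((toCLM a).le_opNorm v).trans (by gcongr; exact norm_scalar_vector_le ξ)
    _ = ‖a‖ * ‖ξ‖ * ‖η‖ := by rw [norm_def]; ring

section Comm
open WeakDual
variable {M : Type*} [CommCStarAlgebra M]

theorem norm_le_of_forall_character {C : ℝ} (hC : 0 ≤ C) (a : M)
    (h : ∀ χ : characterSpace ℂ M, ‖χ a‖ ≤ C) : ‖a‖ ≤ C := by
  rw [← (AddMonoidHomClass.isometry_iff_norm _).1 (gelfandTransform_isometry M) a]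
  exact (ContinuousMap.norm_le _ hC).2 h

theorem norm_character_apply_le (χ : characterSpace ℂ M) (a : M) : ‖χ a‖ ≤ ‖a‖ := by
  rw [← (AddMonoidHomClass.isometry_iff_norm _).1 (gelfandTransform_isometry M) a]
  exact ContinuousMap.norm_coe_le_norm (gelfandTransform ℂ M a) χ

variable [PartialOrder M] [StarOrderedRing M]

open WithCStarModule in
theorem character_sum_inner_self (χ : characterSpace ℂ M) (u : C⋆ᵐᵒᵈ(M, m → M)) :
    χ (∑ i, inner M (u i) (u i)) =
      ((‖(WithLp.toLp 2 fun i => χ (u i) : EuclideanSpace ℂ m)‖ ^ 2 : ℝ) : ℂ) := by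
  rw [EuclideanSpace.norm_sq_eq, map_sum, Complex.ofReal_sum]
  refine Finset.sum_congr rfl fun i _ => ?_
  rw [WithCStarModule.inner_def, map_mul, map_star]
  simp [Complex.mul_conj, Complex.normSq_eq_norm_sq]

open WithCStarModule in
/-- The norm of a matrix over a commutative algebra is controlled by its bilinear form at complex
vectors: apply each character to the entries and use complex matrices. -/
theorem norm_le_of_forall_bilin {C : ℝ} (hC : 0 ≤ C) (a : CStarMatrix m n M)
    (h : ∀ (ξ : EuclideanSpace ℂ m) (η : EuclideanSpace ℂ n), ‖bilin ξ η a‖ ≤ C * ‖ξ‖ * ‖η‖) :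
    ‖a‖ ≤ C := by
  rw [norm_def]
  refine ContinuousLinearMap.opNorm_le_bound _ hC fun v => ?_
  rw [← abs_of_nonneg (norm_nonneg (toCLM a v)), ← abs_of_nonneg (mul_nonneg hC (norm_nonneg v)),
    ← sq_le_sq, mul_pow, pi_norm_sq]
  refine norm_le_of_forall_character (by positivity) _ fun χ => ?_
  set ξ : EuclideanSpace ℂ m := WithLp.toLp 2 fun i => χ (v i) with hξ
  set ζ : EuclideanSpace ℂ n := WithLp.toLp 2 fun i => χ (toCLM a v i) with hζ
  have hξv : ‖ξ‖ ^ 2 ≤ ‖v‖ ^ 2 := by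
    rw [pi_norm_sq]
    have := norm_character_apply_le χ (∑ i, inner M (v i) (v i))
    rwa [character_sum_inner_self, ← hξ, Complex.norm_real,
      Real.norm_of_nonneg (by positivity)] at this
  rw [character_sum_inner_self, ← hζ, Complex.norm_real, Real.norm_of_nonneg (by positivity)]
  have hζξ : ‖ζ‖ * ‖ζ‖ ≤ C * ‖ξ‖ * ‖ζ‖ := by
    -- Evaluate the bilinear form at `ξ` and the conjugate of `ζ = ξ (χ a)`.
    have h1 := h ξ (WithLp.toLp 2 fun j => star (ζ j))
    have h2 : χ (bilin ξ (WithLp.toLp 2 fun j => star (ζ j)) a) = ((‖ζ‖ ^ 2 : ℝ) : ℂ) := by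
      rw [EuclideanSpace.norm_sq_eq, bilin, Finset.sum_comm, map_sum, Complex.ofReal_sum]
      refine Finset.sum_congr rfl fun j _ => ?_
      have : ζ j = ∑ i, ξ i * χ (a i j) := by
        simp [hζ, hξ, toCLM_apply_eq_sum]
      rw [Complex.ofReal_pow, ← Complex.mul_conj', map_sum]
      nth_rw 1 [this]
      rw [Finset.sum_mul]
      refine Finset.sum_congr rfl fun i _ => ?_
      simp
      ring
    have h3 := (norm_character_apply_le χ _).trans h1
    rw [h2, Complex.norm_real, Real.norm_of_nonneg (by positivity)] at h3
    have h4 : ‖(WithLp.toLp 2 fun j => star (ζ j) : EuclideanSpace ℂ n)‖ = ‖ζ‖ := by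
      simp [EuclideanSpace.norm_eq]
    rw [h4] at h3
    nlinarith
  have h5 : ‖ζ‖ ≤ C * ‖ξ‖ := by
    rcases (norm_nonneg ζ).eq_or_lt with h0 | h0
    · rw [← h0]; positivity
    · exact le_of_mul_le_mul_right hζξ h0
  calc ‖ζ‖ ^ 2 ≤ (C * ‖ξ‖) ^ 2 := by gcongr
    _ ≤ C ^ 2 * ‖v‖ ^ 2 := by rw [mul_pow]; gcongr

end Comm
end CStarMatrix

/-! ### A predual of the algebra of matrices -/

namespace CStarMatrix
variable {m n : Type} [Fintype m] [Fintype n]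
variable {M : Type u} [CommCStarAlgebra M] [PartialOrder M] [StarOrderedRing M]
variable {X : Type u} [NormedAddCommGroup X] [NormedSpace ℂ X]
variable (e : StrongDual ℂ X ≃ₗᵢ⋆[ℂ] M)

omit [PartialOrder M] [StarOrderedRing M] in
theorem symm_smul_apply (c : ℂ) (a : M) (x : X) : e.symm (c • a) x = star c * e.symm a x := by
  rw [LinearIsometryEquiv.map_smulₛₗ]
  rfl

/-- The pairing `∑ i j, ⟨a i j, x i j⟩` of `x : m → n → X` and a matrix `a` over the dual `M` of `X`.
It is conjugate linear in `a` because `e` is. -/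
noncomputable def pairing :
    (m → n → X) →L[ℂ] CStarMatrix m n M →L⋆[ℂ] ℂ :=
  LinearMap.mkContinuous₂
    (LinearMap.mk₂'ₛₗ (RingHom.id ℂ) (starRingEnd ℂ)
      (fun (x : m → n → X) (a : CStarMatrix m n M) => ∑ i, ∑ j, e.symm (a i j) (x i j))
      (fun x y a => by simp [Finset.sum_add_distrib])
      (fun c x a => by simp [Finset.mul_sum])
      (fun x a b => by simp [Finset.sum_add_distrib])
      (fun c x a => by simp [symm_smul_apply, Finset.mul_sum]))
    (Fintype.card m * Fintype.card n) (fun x a => by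
      have h (i : m) (j : n) : ‖e.symm (a i j) (x i j)‖ ≤ ‖x‖ * ‖a‖ := by
        refine ((e.symm (a i j)).le_opNorm _).trans ?_
        rw [e.symm.norm_map, mul_comm]
        gcongr
        · exact (norm_le_pi_norm (x i) j).trans (norm_le_pi_norm x i)
        · exact norm_entry_le_norm
      calc ‖∑ i, ∑ j, e.symm (a i j) (x i j)‖ ≤ ∑ i, ∑ j, ‖e.symm (a i j) (x i j)‖ :=
            (norm_sum_le _ _).trans (Finset.sum_le_sum fun i _ => norm_sum_le _ _)
        _ ≤ ∑ _ : m, ∑ _ : n, ‖x‖ * ‖a‖ :=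
            Finset.sum_le_sum fun i _ => Finset.sum_le_sum fun j _ => h i j
        _ = Fintype.card m * Fintype.card n * ‖x‖ * ‖a‖ := by simp; ring)

theorem pairing_apply (x : m → n → X) (a : CStarMatrix m n M) :
    pairing e x a = ∑ i, ∑ j, e.symm (a i j) (x i j) := rfl

theorem pairing_single [DecidableEq m] [DecidableEq n] (x : X) (i : m) (j : n)
    (a : CStarMatrix m n M) :
    pairing e (Pi.single i (Pi.single j x)) a = e.symm (a i j) x := by
  rw [pairing_apply, Finset.sum_eq_single i, Finset.sum_eq_single j]
  · simp
  · intro l _ hl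
    simp [hl]
  · simp
  · intro k _ hk
    simp [hk]
  · simp

theorem pairing_smul (x : X) (ξ : EuclideanSpace ℂ m) (η : EuclideanSpace ℂ n)
    (a : CStarMatrix m n M) :
    pairing e (fun i j => star (ξ i * η j) • x) a = e.symm (bilin ξ η a) x := by
  simp [pairing_apply, bilin, map_sum, symm_smul_apply]

theorem norm_pairing_smul_le (x : X) (ξ : EuclideanSpace ℂ m) (η : EuclideanSpace ℂ n) :
    ‖pairing e (fun i j => star (ξ i * η j) • x)‖ ≤ ‖x‖ * ‖ξ‖ * ‖η‖ := by
  refine ContinuousLinearMap.opNorm_le_bound _ (by positivity) fun a => ?_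
  rw [pairing_smul]
  calc ‖e.symm (bilin ξ η a) x‖ ≤ ‖bilin ξ η a‖ * ‖x‖ := by
        rw [← e.symm.norm_map]
        exact (e.symm (bilin ξ η a)).le_opNorm x
    _ ≤ (‖a‖ * ‖ξ‖ * ‖η‖) * ‖x‖ := by gcongr; exact norm_bilin_le ξ η a
    _ = _ := by ring

theorem norm_single_le [DecidableEq m] [DecidableEq n] (i : m) (j : n) (a : M) :
    ‖(ofMatrix (Matrix.single i j a) : CStarMatrix m n M)‖ ≤ ‖a‖ := by
  refine norm_le_of_forall_bilin (norm_nonneg a) _ fun ξ η => ?_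
  have : bilin ξ η (ofMatrix (Matrix.single i j a)) = (ξ i * η j) • a := by
    rw [bilin, Finset.sum_eq_single i, Finset.sum_eq_single j]
    · simp
    · intro l _ hl
      simp [Matrix.single_apply_of_col_ne _ _ hl.symm]
    · simp
    · intro k _ hk
      simp [Matrix.single_apply_of_row_ne hk.symm]
    · simp
  rw [this, norm_smul, norm_mul, mul_comm, mul_assoc]
  gcongr
  · exact PiLp.norm_apply_le ξ i
  · exact PiLp.norm_apply_le η j

/-- With the upper bound for `pairing`, the norm induced by `pairing` is equivalent to the supremum
norm; this gives completeness of `MatrixPredual`. -/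
theorem le_norm_pairing (x : m → n → X) : ‖x‖ ≤ ‖pairing e x‖ := by
  classical
  refine (pi_norm_le_iff_of_nonneg (norm_nonneg _)).2 fun i =>
    (pi_norm_le_iff_of_nonneg (norm_nonneg _)).2 fun j => ?_
  obtain ⟨f, hf, hfx⟩ := exists_dual_vector'' ℂ (x i j)
  have h := (pairing e x).le_opNorm (ofMatrix (Matrix.single i j (e f)))
  have h2 : pairing e x (ofMatrix (Matrix.single i j (e f))) = f (x i j) := by
    rw [pairing_apply, Finset.sum_eq_single i, Finset.sum_eq_single j]
    · simp
    · intro l _ hl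
      simp [Matrix.single_apply_of_col_ne _ _ hl.symm]
    · simp
    · intro k _ hk
      simp [Matrix.single_apply_of_row_ne hk.symm]
    · simp
  rw [h2, hfx] at h
  simp only [RCLike.norm_ofReal, abs_norm] at h
  refine h.trans (mul_le_of_le_one_right (norm_nonneg _) ((norm_single_le _ _ _).trans ?_))
  rwa [e.norm_map]

variable (m n) in
/-- The predual of the matrices over `M` attached to a predual `X` of `M`: the conjugate linear
functionals `a ↦ ∑ i j, ⟨a i j, x i j⟩`, with the norm dual to that of the matrices. -/
def MatrixPredual : Type u := (pairing (m := m) (n := n) e).toLinearMap.range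

noncomputable instance : NormedAddCommGroup (MatrixPredual m n e) :=
  inferInstanceAs (NormedAddCommGroup (pairing (m := m) (n := n) e).toLinearMap.range)

noncomputable instance : NormedSpace ℂ (MatrixPredual m n e) :=
  inferInstanceAs (NormedSpace ℂ (pairing (m := m) (n := n) e).toLinearMap.range)

instance [CompleteSpace X] : CompleteSpace (MatrixPredual m n e) := by
  have h : IsClosed (Set.range (pairing (m := m) (n := n) e)) :=
    ((pairing (m := m) (n := n) e).antilipschitz_of_bound (K := 1)
      fun x => by simpa using le_norm_pairing e x).isClosed_range
      (pairing (m := m) (n := n) e).uniformContinuous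
  exact h.completeSpace_coe

/-- The functional attached to a family in `X`, as an element of the predual. -/
noncomputable def toPredual : (m → n → X) →L[ℂ] MatrixPredual m n e :=
  LinearMap.mkContinuous (pairing (m := m) (n := n) e).toLinearMap.rangeRestrict
    ‖pairing (m := m) (n := n) e‖ (pairing (m := m) (n := n) e).le_opNorm

theorem toPredual_surjective : Function.Surjective (toPredual (m := m) (n := n) e) :=
  (pairing (m := m) (n := n) e).toLinearMap.surjective_rangeRestrict

theorem norm_toPredual (x : m → n → X) : ‖toPredual e x‖ = ‖pairing e x‖ := rfl

/-- The functional on `MatrixPredual` given by evaluation at a matrix. -/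
noncomputable def evalPredual : CStarMatrix m n M →ₗ⋆[ℂ] StrongDual ℂ (MatrixPredual m n e) where
  toFun a := LinearMap.mkContinuous
    { toFun := fun p => p.1 a
      map_add' := fun _ _ => rfl
      map_smul' := fun _ _ => rfl } ‖a‖ fun p => (p.1.le_opNorm a).trans_eq (mul_comm _ _)
  map_add' a b := by
    ext p
    exact map_add p.1 a b
  map_smul' c a := by
    ext p
    exact map_smulₛₗ p.1 c a

theorem evalPredual_toPredual (a : CStarMatrix m n M) (x : m → n → X) :
    evalPredual e a (toPredual e x) = pairing e x a := rfl

theorem norm_evalPredual (a : CStarMatrix m n M) : ‖evalPredual e a‖ = ‖a‖ := by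
  refine le_antisymm (ContinuousLinearMap.opNorm_le_bound _ (norm_nonneg a) fun p =>
      (p.1.le_opNorm a).trans_eq (mul_comm _ _))
    (norm_le_of_forall_bilin (norm_nonneg _) a fun ξ η => ?_)
  rw [← e.symm.norm_map]
  refine ContinuousLinearMap.opNorm_le_bound _ (by positivity) fun x => ?_
  rw [← pairing_smul, ← evalPredual_toPredual]
  refine ((evalPredual e a).le_opNorm _).trans ?_
  rw [mul_assoc, mul_assoc, norm_toPredual]
  gcongr
  exact (norm_pairing_smul_le e x ξ η).trans (le_of_eq (by ring))

theorem evalPredual_surjective : Function.Surjective (evalPredual (m := m) (n := n) e) := by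
  classical
  intro φ
  let ι (i : m) (j : n) : X →L[ℂ] (m → n → X) :=
    (ContinuousLinearMap.single ℂ (fun _ : m => n → X) i).comp
      (ContinuousLinearMap.single ℂ (fun _ : n => X) j)
  refine ⟨ofMatrix (Matrix.of fun i j => e (φ.comp ((toPredual e).comp (ι i j)))), ?_⟩
  ext p
  obtain ⟨x, rfl⟩ := toPredual_surjective e p
  rw [evalPredual_toPredual]
  have hx : x = ∑ i, ∑ j, ι i j (x i j) := by
    ext k l
    simp [ι, Finset.sum_apply, Pi.single_apply, ite_apply]
  have hentry (i : m) (j : n) : e.symm ((ofMatrix (Matrix.of fun i j =>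
      e (φ.comp ((toPredual e).comp (ι i j)))) : CStarMatrix m n M) i j) =
        φ.comp ((toPredual e).comp (ι i j)) := e.symm_apply_apply _
  simp only [pairing_apply, hentry, ContinuousLinearMap.comp_apply, ← map_sum, ← hx]

/-- The dual of `MatrixPredual` is the algebra of matrices over `M`, isometrically. -/
noncomputable def dualMatrixPredual :
    StrongDual ℂ (MatrixPredual m n e) ≃ₗᵢ⋆[ℂ] CStarMatrix m n M :=
  (LinearIsometryEquiv.ofSurjective ⟨evalPredual e, norm_evalPredual e⟩
    (evalPredual_surjective e)).symm

/-- Each presentation of `M` as a dual space yields one of the matrices over `M`, for which the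
entries are continuous by construction. -/
theorem continuous_entry_wstarTopology [DecidableEq n] (i j : n) :
    @Continuous _ _ (wstarTopology (CStarMatrix n n M)) (wstarTopology M)
      (fun a : CStarMatrix n n M => a i j) := by
  simp only [continuous_iInf_rng, continuous_induced_rng]
  intro X _ _ _ e
  refine continuous_iInf_dom (i := MatrixPredual n n e) <|
    continuous_iInf_dom (i := inferInstance) <| continuous_iInf_dom (i := inferInstance) <|
    continuous_iInf_dom (i := inferInstance) <|
    continuous_iInf_dom (i := dualMatrixPredual e) ?_
  refine @WeakDual.continuous_of_continuous_eval _ _ _ _ _ _ _ _ _ _ (_) _ fun x => ?_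
  have h := @Continuous.comp _ _ _ (_) _ _ _ _
    (WeakDual.eval_continuous (toPredual e (Pi.single i (Pi.single j x))))
    (continuous_induced_dom (f := fun a : CStarMatrix n n M =>
      StrongDual.toWeakDual ((dualMatrixPredual e).symm a)))
  convert h using 2 with a
  exact (pairing_single e x i j a).symm

end CStarMatrix

/-! ### The functionals of conditions (iii) and (iv), and orthogonality -/

namespace ReductionConditions
variable {M : Type u} [CommCStarAlgebra M]
variable {H : Type v} [NormedAddCommGroup H] [InnerProductSpace ℂ H]

/-- The functional `c ↦ ⟨G i j c, G k l 1⟩` in the notation of (iii). -/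
noncomputable def innerOne (G : Fin 2 → Fin 2 → M →ₗ[ℂ] H) (i j k l : Fin 2) : M →ₗ[ℂ] ℂ :=
  (innerₛₗ ℂ (G k l 1)).comp (G i j)

variable {G : Fin 2 → Fin 2 → M →ₗ[ℂ] H} (hG : ReductionConditions G)
include hG

theorem inner_eq_innerOne (i j k l : Fin 2) (a b : M) :
    inner ℂ (G k l b) (G i j a) = innerOne G i j k l (star b * a) :=
  hG.module_property a b i j k l

theorem innerOne_swap (i j k l : Fin 2) (a : M) :
    innerOne G k l i j a = star (innerOne G i j k l (star a)) := by
  have h := hG.inner_eq_innerOne i j k l 1 a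
  rw [mul_one] at h
  rw [← h]
  exact (inner_conj_symm (G i j 1) (G k l a)).symm

/-- Condition (ii), polarized: it gives the identity on squares, and `4 a` is a difference of two
squares of self-adjoint elements. -/
theorem innerOne_diag_sum (a : M) (ha : IsSelfAdjoint a) :
    innerOne G 0 1 0 1 a + innerOne G 1 0 1 0 a = innerOne G 0 0 0 0 a + innerOne G 1 1 1 1 a := by
  have hsq : ∀ b : M, IsSelfAdjoint b → innerOne G 0 1 0 1 (b * b) + innerOne G 1 0 1 0 (b * b) =
      innerOne G 0 0 0 0 (b * b) + innerOne G 1 1 1 1 (b * b) := by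
    intro b hb
    have h (i j : Fin 2) : innerOne G i j i j (b * b) = ((‖G i j b‖ ^ 2 : ℝ) : ℂ) := by
      nth_rw 1 [← hb.star_eq]
      rw [← hG.inner_eq_innerOne, inner_self_eq_norm_sq_to_K]
      simp
    rw [h, h, h, h]
    exact_mod_cast hG.norm_sq b
  have h1 := hsq (a + 1) (ha.add (.one M))
  have h2 := hsq (a - 1) (ha.sub (.one M))
  have h4 : (4 : ℂ) • a = (a + 1) * (a + 1) - (a - 1) * (a - 1) := by
    rw [ofNat_smul_eq_nsmul ℂ 4 a]
    simp only [nsmul_eq_mul]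
    push_cast
    ring
  have h5 (i j : Fin 2) : 4 * innerOne G i j i j a =
      innerOne G i j i j ((a + 1) * (a + 1)) - innerOne G i j i j ((a - 1) * (a - 1)) := by
    rw [← map_sub, ← h4, map_smul, smul_eq_mul]
  linear_combination (1 / 4) * (h5 0 1 + h5 1 0 - h5 0 0 - h5 1 1 + h1 - h2)

variable [WStarAlgebra M]

/-- Condition (iv) on all of `M`, together with its complex conjugate. -/
theorem innerOne_symmetry (hc : ∀ i j k l, Continuous (innerOne G i j k l)) :
    innerOne G 0 1 0 0 = innerOne G 1 1 1 0 ∧ innerOne G 1 0 0 0 = innerOne G 1 1 0 1 ∧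
      innerOne G 0 0 0 1 = innerOne G 1 0 1 1 ∧ innerOne G 0 0 1 0 = innerOne G 0 1 1 1 := by
  have h1 : innerOne G 0 1 0 0 = innerOne G 1 1 1 0 :=
    linearMap_eq_of_eq_on_isStarProjection (hc _ _ _ _) (hc _ _ _ _) fun p hp => by
      refine (hG.symmetry_one p hp).trans ?_
      rw [hG.inner_eq_innerOne, mul_one, hp.isSelfAdjoint.star_eq]
  have h2 : innerOne G 1 0 0 0 = innerOne G 1 1 0 1 :=
    linearMap_eq_of_eq_on_isStarProjection (hc _ _ _ _) (hc _ _ _ _) fun p hp => by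
      refine (hG.symmetry_two p hp).trans ?_
      rw [hG.inner_eq_innerOne, mul_one, hp.isSelfAdjoint.star_eq]
  refine ⟨h1, h2, ?_, ?_⟩
  · ext a
    rw [hG.innerOne_swap 0 1 0 0, hG.innerOne_swap 1 1 1 0, h1]
  · ext a
    rw [hG.innerOne_swap 1 0 0 0, hG.innerOne_swap 1 1 0 1, h2]

variable [PartialOrder M] [StarOrderedRing M]

/-- The sixteen terms of `⟨F p, F q⟩` cancel by (i), (ii) and (iv), using only the entries of
`p * q = 0` and `q * p = 0`. -/
theorem preservesOrthogonality (hc : ∀ i j k l, Continuous (innerOne G i j k l))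
    (F : CStarMatrix (Fin 2) (Fin 2) M →ₗ[ℂ] H) (hF : ∀ a, F a = ∑ i, ∑ j, G i j (a i j)) :
    PreservesOrthogonality F := by
  intro q p hq hp hqp
  have hpq : p * q = 0 := by
    have := congrArg star hqp
    rwa [star_mul, hq.isSelfAdjoint.star_eq, hp.isSelfAdjoint.star_eq, star_zero] at this
  have ent (a b : CStarMatrix (Fin 2) (Fin 2) M) (hab : a * b = 0) (i j : Fin 2) :
      a i 0 * b 0 j + a i 1 * b 1 j = 0 := by
    rw [← Fin.sum_univ_two (f := fun k => a i k * b k j), ← CStarMatrix.mul_apply, hab]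
    rfl
  have st (a : CStarMatrix (Fin 2) (Fin 2) M) (ha : IsStarProjection a) (i j : Fin 2) :
      star (a i j) = a j i := by
    rw [← CStarMatrix.star_apply, ha.isSelfAdjoint.star_eq]
  obtain ⟨s1, s2, s3, s4⟩ := hG.innerOne_symmetry hc
  have o1 (a : M) : innerOne G 0 0 1 1 a = 0 := hG.diag_orthogonal a 1
  have o2 (a : M) : innerOne G 0 1 1 0 a = 0 := hG.offDiag_orthogonal a 1
  have o3 (a : M) : innerOne G 1 1 0 0 a = 0 := by rw [hG.innerOne_swap 0 0 1 1, o1, star_zero]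
  have o4 (a : M) : innerOne G 1 0 0 1 a = 0 := by rw [hG.innerOne_swap 0 1 1 0, o2, star_zero]
  have pair (f : M →ₗ[ℂ] ℂ) (a b : M) (hab : a + b = 0) : f a + f b = 0 := by
    rw [← map_add, hab, map_zero]
  have c1 := pair (innerOne G 1 0 1 1) (q 1 0 * p 0 0) (q 1 1 * p 1 0) (ent q p hqp 1 0)
  have c2 := pair (innerOne G 0 1 1 1) (q 0 1 * p 0 0) (q 1 1 * p 0 1) (by
    linear_combination ent p q hpq 0 1)
  have c3 := pair (innerOne G 1 1 1 0) (q 0 0 * p 0 1) (q 0 1 * p 1 1) (ent q p hqp 0 1)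
  have c4 := pair (innerOne G 1 1 0 1) (q 0 0 * p 1 0) (q 1 0 * p 1 1) (by
    linear_combination ent p q hpq 1 0)
  have e1 : q 1 0 * p 0 1 = -(q 0 0 * p 0 0) := by linear_combination ent p q hpq 0 0
  have e2 : q 0 1 * p 1 0 = -(q 0 0 * p 0 0) := by linear_combination ent q p hqp 0 0
  have e3 : q 1 1 * p 1 1 = q 0 0 * p 0 0 := by
    linear_combination ent p q hpq 1 1 - e2
  have hd := hG.innerOne_diag_sum (q 0 0 * p 0 0) (by
    rw [IsSelfAdjoint, star_mul, st q hq, st p hp, mul_comm])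
  simp only [hF, Fin.sum_univ_two, inner_add_left, inner_add_right, hG.inner_eq_innerOne, st q hq,
    o1, o2, o3, o4, e1, e2, e3, map_neg, s1, s2, s3, s4]
  linear_combination c1 + c2 + c3 + c4 - hd

end ReductionConditions

/-! ### The map with given reductions -/

theorem norm_topology_le_wstarTopology (A : Type u) [CStarAlgebra A] :
    (inferInstance : TopologicalSpace A) ≤ wstarTopology A := by
  simp only [wstarTopology, le_iInf_iff]
  intro X _ _ _ e
  rw [← continuous_iff_le_induced]
  exact NormedSpace.Dual.toWeakDual_continuous.comp e.symm.continuous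

/-- A `w*`-continuous functional is norm continuous. -/
theorem IsWStarContinuous.continuous_inner {A : Type u} [CStarAlgebra A]
    {H : Type v} [NormedAddCommGroup H] [InnerProductSpace ℂ H] {F : A →ₗ[ℂ] H}
    (hF : IsWStarContinuous F) (x : H) : Continuous fun a => inner ℂ x (F a) := by
  have h := continuous_le_dom (norm_topology_le_wstarTopology A) hF
  exact (WeakBilin.eval_continuous (topDualPairing ℂ H).flip (innerSL ℂ x)).comp h

theorem IsOVF.continuous {A : Type u} [CStarAlgebra A]
    {H : Type v} [NormedAddCommGroup H] [InnerProductSpace ℂ H] {F : A →ₗ[ℂ] H}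
    (hF : IsOVF F) : Continuous F := by
  obtain ⟨C, hC⟩ := hF.bounded
  exact AddMonoidHomClass.continuous_of_bound F C hC

section
variable {M : Type u} [CommCStarAlgebra M] {H : Type v} [NormedAddCommGroup H]
  [InnerProductSpace ℂ H]

/-- The linear map whose value at `a εᵢⱼ` is `G i j a`. -/
noncomputable def ofReductions (G : Fin 2 → Fin 2 → M →ₗ[ℂ] H) :
    CStarMatrix (Fin 2) (Fin 2) M →ₗ[ℂ] H where
  toFun a := ∑ i, ∑ j, G i j (a i j)
  map_add' a b := by simp [Finset.sum_add_distrib]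
  map_smul' c a := by simp

theorem hasReductions_iff (F : CStarMatrix (Fin 2) (Fin 2) M →ₗ[ℂ] H)
    (G : Fin 2 → Fin 2 → M →ₗ[ℂ] H) : HasReductions F G ↔ F = ofReductions G := by
  constructor
  · intro h
    ext a
    have ha : a = ∑ i, ∑ j, CStarMatrix.ofMatrix (Matrix.single i j (a i j)) :=
      Matrix.matrix_eq_sum_single a
    conv_lhs => rw [ha]
    simp only [map_sum, h _ _ _]
    rfl
  · rintro rfl i j a
    fin_cases i <;> fin_cases j <;> simp [ofReductions]

variable [PartialOrder M] [StarOrderedRing M]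

theorem ofReductions_bounded {G : Fin 2 → Fin 2 → M →ₗ[ℂ] H} (hG : ∀ i j, IsOVF (G i j)) :
    ∃ C : ℝ, ∀ a, ‖ofReductions G a‖ ≤ C * ‖a‖ := by
  choose C hC using fun i j => (hG i j).bounded
  refine ⟨∑ i, ∑ j, |C i j|, fun a => ?_⟩
  simp only [Finset.sum_mul]
  change ‖∑ i, ∑ j, G i j (a i j)‖ ≤ _
  refine (norm_sum_le _ _).trans (Finset.sum_le_sum fun i _ =>
    (norm_sum_le _ _).trans (Finset.sum_le_sum fun j _ => (hC i j _).trans ?_))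
  gcongr
  · exact le_abs_self _
  · exact CStarMatrix.norm_entry_le_norm

theorem ofReductions_isWStarContinuous {G : Fin 2 → Fin 2 → M →ₗ[ℂ] H}
    (hG : ∀ i j, IsWStarContinuous (G i j)) : IsWStarContinuous (ofReductions G) := by
  have h (i j : Fin 2) := @Continuous.comp _ _ _ (_) (_) _ _ _ (hG i j)
    (CStarMatrix.continuous_entry_wstarTopology (M := M) i j)
  have h' := fun i => @continuous_finsetSum _ (WeakSpace ℂ H) _ (wstarTopology _) _ _ _ _
    Finset.univ fun j _ => h i j
  have := @continuous_finsetSum _ (WeakSpace ℂ H) _ (wstarTopology _) _ _ _ _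
    Finset.univ fun i _ => h' i
  unfold IsWStarContinuous
  convert this using 2 with a
  simp [ofReductions]
end

theorem theorem3 {M : Type u} [CommCStarAlgebra M] [PartialOrder M] [StarOrderedRing M]
    [WStarAlgebra M]
    {H : Type v} [NormedAddCommGroup H] [InnerProductSpace ℂ H] [CompleteSpace H]
    (G : Fin 2 → Fin 2 → M →ₗ[ℂ] H) (hG : ReductionConditions G) :
    (∃! F : CStarMatrix (Fin 2) (Fin 2) M →ₗ[ℂ] H, HasReductions F G) ∧
    ∀ F : CStarMatrix (Fin 2) (Fin 2) M →ₗ[ℂ] H, HasReductions F G →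
      ((∀ i j, IsOVF (G i j)) → IsOVF F) ∧
      ((∀ i j, IsWStarContinuousOVF (G i j)) → IsWStarContinuousOVF F) := by
  simp only [hasReductions_iff, existsUnique_eq, forall_eq, true_and]
  refine ⟨fun h => ⟨ofReductions_bounded h, ?_⟩,
    fun h => ⟨ofReductions_isWStarContinuous fun i j => (h i j).continuity, ?_⟩⟩
  · exact hG.preservesOrthogonality
      (fun i j k l => (innerSL ℂ (G k l 1)).continuous.comp (h i j).continuous) _ fun _ => rfl
  · exact hG.preservesOrthogonality
      (fun i j k l => (h i j).continuity.continuous_inner (G k l 1)) _ fun _ => rfl
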